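/- Let $L=\mathbb Q(\alpha)$ be a number field, $\mathbb Z[\alpha]\subseteq L$ the subring generated by $\alpha$, $R=L[X_1,\dots,X_n]$, and let $\mathfrak a=(f_1,\dots,f_s)\subseteq R$ be an ideal given by a finite system of generators $f_j\in\mathbb Z[\alpha][X_1,\dots,X_n]$. For a prime number $p$ and a ring homomorphism $\psi:\mathbb Z[\alpha]\to\mathbb F_p$ (for instance, when $\alpha$ is an algebraic integer, the homomorphism sending $\alpha$ to a simple root $\beta_p\in\mathbb F_p$ of the minimal polynomial of $\alpha$ modulo $p$), let $\tilde f_j\in\mathbb F_p[X_1,\dots,X_n]$ be obtained by applying $\psi$ to the coefficients of $f_j$, and put $\tilde{\mathfrak a}=\tilde{\mathfrak a}_{p,\psi}=(\tilde f_1,\dots,\tilde f_s)\subseteq R_p=\mathbb F_p[X_1,\dots,X_n]$. For an ideal $\mathfrak b$ of $S=k[X_1,\dots,X_n]$, $k$ a field, the affine Hilbert function is $HF^a_{S/\mathfrak b}(i)=\dim_k(S_{\le i}/(S_{\le i}\cap\mathfrak b))$, $i\in\mathbb Z$, where $S_{\le i}$ is the space of polynomials of total degree at most $i$; the affine Hilbert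 polynomial $HP^a_{S/\mathfrak b}\in\mathbb Q[t]$ is the polynomial that agrees with it at all large $i$; $\dim\mathfrak b$ is the degree of $HP^a_{S/\mathfrak b}$ (and $-1$ if $\mathfrak b=S$); $\deg\mathfrak b$ is $(\dim \mathfrak b)!$ times the leading coefficient of $HP^a_{S/\mathfrak b}$; and $\operatorname{mult}(\mathfrak b)=\deg(\sqrt{\mathfrak b})/\deg(\mathfrak b)$ (the inverse of the more usual ratio; the two conventions are preserved simultaneously). Here $\operatorname{mult}$ is used for any proper ideal, primary or not. Then: 1. There are only finitely many primes $p$ for which, for some $\psi:\mathbb Z[\alpha]\to\mathbb F_p$, the functions $HF^a_{R/\mathfrak a}$ and $HF^a_{R_p/\tilde{\mathfrak a}}$ differ or $\dim\mathfrak a\ne\dim\tilde{\mathfrak a}$. 2. If $\mathfrak a$ is a primary component of some ideal of $R$ (i.e. occurs in a minimal primary decomposition of it), then there are only finitely many primes $p$ for which, for some $\psi:\mathbb Z[\alpha]\to\mathbb F_p$, $\operatorname{mult}(\tilde{\mathfrak a})\neq\operatorname{mult}(\mathfrak a)$. -/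

import Mathlib

/-- The reduction `(f̃₁, …, f̃ₛ)` of a system of generators along a ring homomorphism `ψ`
(applied to the coefficients). -/
noncomputable def reducedIdeal {A k : Type*} [CommRing A] [CommRing k] {n s : ℕ} (ψ : A →+* k)
    (f : Fin s → MvPolynomial (Fin n) A) : Ideal (MvPolynomial (Fin n) k) :=
  Ideal.span (Set.range fun j => MvPolynomial.map ψ (f j))

noncomputable section AffineHilbert

variable {k : Type*} [Field k] {n : ℕ}

/-- `R_{≤ i}`: the space of polynomials of total degree at most `i`, for an integer `i`
(only `0` when `i < 0`). -/
def polysOfDegreeLE (k : Type*) [Field k] (n : ℕ) (i : ℤ) :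
    Submodule k (MvPolynomial (Fin n) k) :=
  MvPolynomial.restrictSupport k {m : Fin n →₀ ℕ | (m.degree : ℤ) ≤ i}

/-- The affine Hilbert function `i ↦ dim_k (R_{≤ i} / 𝔞_{≤ i})` of `R ⧸ 𝔞`,
where `𝔞_{≤ i} = R_{≤ i} ∩ 𝔞`. -/
def affineHilbertFunction (𝔞 : Ideal (MvPolynomial (Fin n) k)) (i : ℤ) : ℤ :=
  (Module.finrank k
    (polysOfDegreeLE k n i ⧸ (𝔞.restrictScalars k).submoduleOf (polysOfDegreeLE k n i)) : ℤ)

/-- `P` is the affine Hilbert polynomial of `R ⧸ 𝔞`: it takes the same value as the affine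
Hilbert function at every sufficiently large integer. -/
def IsAffineHilbertPolynomial (𝔞 : Ideal (MvPolynomial (Fin n) k)) (P : Polynomial ℚ) : Prop :=
  ∀ᶠ i : ℤ in Filter.atTop, (affineHilbertFunction 𝔞 i : ℚ) = P.eval (i : ℚ)

theorem IsAffineHilbertPolynomial.unique {𝔞 : Ideal (MvPolynomial (Fin n) k)}
    {P Q : Polynomial ℚ} (hP : IsAffineHilbertPolynomial 𝔞 P)
    (hQ : IsAffineHilbertPolynomial 𝔞 Q) : P = Q := by
  obtain ⟨N, hN⟩ := Filter.eventually_atTop.1 (hP.and hQ)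
  refine Polynomial.eq_of_infinite_eval_eq P Q ?_
  refine Set.Infinite.mono (s := ((↑) : ℤ → ℚ) '' Set.Ici N) ?_
    ((Set.Ici_infinite N).image Int.cast_injective.injOn)
  rintro _ ⟨i, hi, rfl⟩
  exact (hN i hi).1.symm.trans (hN i hi).2

open Classical in
/-- The affine Hilbert polynomial of `R ⧸ 𝔞`. -/
def affineHilbertPolynomial (𝔞 : Ideal (MvPolynomial (Fin n) k)) : Polynomial ℚ :=
  if h : ∃ P : Polynomial ℚ, IsAffineHilbertPolynomial 𝔞 P then h.choose else 0

theorem IsAffineHilbertPolynomial.eq {𝔞 : Ideal (MvPolynomial (Fin n) k)}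
    {P : Polynomial ℚ} (hP : IsAffineHilbertPolynomial 𝔞 P) :
    affineHilbertPolynomial 𝔞 = P := by
  have h : ∃ P : Polynomial ℚ, IsAffineHilbertPolynomial 𝔞 P := ⟨P, hP⟩
  rw [affineHilbertPolynomial, dif_pos h]
  exact h.choose_spec.unique hP

open Classical in
/-- The (affine Hilbert) dimension of `R ⧸ 𝔞`: the degree of the affine Hilbert polynomial,
with the convention `-1` when that polynomial is zero, that is, for the unit ideal. -/
def hilbertDim (𝔞 : Ideal (MvPolynomial (Fin n) k)) : ℤ :=
  if affineHilbertPolynomial 𝔞 = 0 then -1 else ((affineHilbertPolynomial 𝔞).natDegree : ℤ)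

/-- The degree of `R ⧸ 𝔞`: `(dim)!` times the leading coefficient of the affine Hilbert
polynomial (for a proper ideal; `0` for the unit ideal). -/
def hilbertDegree (𝔞 : Ideal (MvPolynomial (Fin n) k)) : ℚ :=
  ((hilbertDim 𝔞).toNat.factorial : ℚ) * (affineHilbertPolynomial 𝔞).leadingCoeff

/-- The multiplicity of an ideal in its radical, as the ratio
`deg (√𝔞) / deg 𝔞`. -/
def hilbertMultiplicity (𝔞 : Ideal (MvPolynomial (Fin n) k)) : ℚ :=
  hilbertDegree 𝔞.radical / hilbertDegree 𝔞

end AffineHilbert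

/-- `𝔮` is one of the primary components of `𝔟`: it occurs in some minimal primary
decomposition of `𝔟`. -/
def IsPrimaryComponent {R : Type*} [CommRing R] (𝔮 𝔟 : Ideal R) : Prop :=
  ∃ t : Finset (Ideal R), Submodule.IsMinimalPrimaryDecomposition 𝔟 t ∧ 𝔮 ∈ t

/-!
The theorem compares the ideal `𝔞` with its reduction through *specializations* of the field `L`: a
specialization is a subring of `L` with a homomorphism onto a field, here the localization of
`ℤ[α]` at the kernel of `ψ` with the extension of `ψ`. An element of `L` lies in the domain of the
specializations for all but finitely many `p`
(`FieldSpecialization.finite_setOf_exists_map_eq_zero`), so any statement that follows from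
finitely many elements of `L` lying in the domain holds for all but finitely many `p`
(`FieldSpecialization.finite_setOf_exists_not_of_eventually`). Such statements are those that hold
eventually along the filter `FieldSpecialization.generic`. An ideal `𝔟` of `L[X]` specializes to
`specIdeal 𝔟`, the set of specializations of those of its elements that have coefficients in the
domain; generically this is the ideal generated by the specializations of any given generators
(`FieldSpecialization.eventually_contr_span_eq`).

For the Hilbert function, take a finite monic Gröbner basis of `𝔟` for the degree lexicographic
order. As soon as it has coefficients in the domain `O` of the specialization, division with
remainder takes place over `O`, so the standard monomials of `𝔟` form a basis of `O[X]` modulo the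
contraction of `𝔟`, compatible with total degree. This survives the passage to the residue field
(`IsMonomialComplement.map`), and counting standard monomials gives equality of Hilbert functions
(`IsMonomialComplement.affineHilbertFunction_eq`). The dimension and the degree are determined by
the Hilbert function.

For the multiplicity, only the degree of the radical remains, and since `specIdeal 𝔞` and
`specIdeal √𝔞` have the same radical it suffices that `specIdeal √𝔞` is generically radical. The
ideal `√𝔞` is prime because `𝔞` is primary. By generic smoothness its coordinate ring over `ℤ[α]`
becomes standard smooth after inverting some `c ∉ √𝔞`, so all fibres are reduced where `c` is
invertible (`Ideal.exists_pow_mul_mem_map_of_mem_radical`). The freeness above, applied to `√𝔞 +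
(c)`, shows that `c` stays a non-zero-divisor modulo the specialized ideal
(`FieldSpecialization.eventually_mem_specIdeal_of_mul_mem`), so nothing is lost by inverting it.
-/

/-! ### Generic smoothness and reduced fibres -/

open TensorProduct in
/-- A standard smooth algebra is étale, hence flat, over a polynomial ring, so it embeds into its
base change to the field of rational functions, which is étale over that field. -/
theorem Algebra.IsStandardSmooth.isReduced_of_field (k S : Type*) [Field k] [CommRing S]
    [Algebra k S] [Algebra.IsStandardSmooth k S] : IsReduced S := by
  obtain ⟨n, g, -, hg⟩ := RingHom.IsStandardSmooth.exists_etale_mvPolynomial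
    (f := algebraMap k S) (by simpa [RingHom.isStandardSmooth_algebraMap])
  algebraize [g]
  let D := MvPolynomial (Fin n) k
  let F := FractionRing D
  have : IsReduced (F ⊗[D] S) := Algebra.FormallyUnramified.isReduced_of_field F (F ⊗[D] S)
  have hinj : Function.Injective
      (Algebra.TensorProduct.includeRight : S →ₐ[D] F ⊗[D] S) :=
    Algebra.TensorProduct.includeRight_injective (IsFractionRing.injective D F)
  exact isReduced_of_injective _ hinj

/-- Generic smoothness: in characteristic zero the generic point of the spectrum of `B` is smooth
over `A`, because the extension of fraction fields is separably generated. -/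
theorem Algebra.exists_isStandardSmooth_localizationAway (A B : Type*) [CommRing A] [IsDomain A]
    [CharZero A] [CommRing B] [IsDomain B] [Algebra A B] [FaithfulSMul A B]
    [Algebra.FinitePresentation A B] :
    ∃ c : B, c ≠ 0 ∧ Algebra.IsStandardSmooth A (Localization.Away c) := by
  let K := FractionRing A
  let E := FractionRing B
  let _ : Algebra K E := FractionRing.liftAlgebra A E
  have : IsScalarTower A K E := FractionRing.isScalarTower_liftAlgebra A E
  have : CharZero K := charZero_of_injective_algebraMap (IsFractionRing.injective A K)
  have : Algebra.EssFiniteType B E := .of_isLocalization _ (nonZeroDivisors B)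
  have : Algebra.EssFiniteType A E := .comp A B E
  have : Algebra.EssFiniteType K E := .of_comp A K E
  have : Algebra.FormallyEtale A K := .of_isLocalization (nonZeroDivisors A)
  have : Algebra.FormallySmooth K E := inferInstance
  have : Algebra.FormallySmooth A E := .comp A K E
  have hE : IsLocalization (⊥ : Ideal B).primeCompl E := by
    convert! (inferInstance : IsLocalization (nonZeroDivisors B) E)
    ext x; simp [Ideal.primeCompl]
  have : Algebra.IsSmoothAt A (⊥ : Ideal B) :=
    Algebra.FormallySmooth.of_equiv
      ((IsLocalization.algEquiv (⊥ : Ideal B).primeCompl E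
        (Localization.AtPrime (⊥ : Ideal B))).restrictScalars A)
  obtain ⟨c, hc, h⟩ := Algebra.IsSmoothAt.exists_notMem_isStandardSmooth A (⊥ : Ideal B)
  exact ⟨c, by simpa using hc, h⟩

open TensorProduct in
/-- If the generic fibre of the affine scheme defined by `I` is integral, then there is a single `c`
outside `I` such that every fibre over a field is reduced away from the zero locus of `c`. -/
theorem Ideal.exists_pow_mul_mem_map_of_mem_radical {A : Type*} [CommRing A] [IsDomain A]
    [CharZero A] [IsNoetherianRing A] {n : ℕ} (I : Ideal (MvPolynomial (Fin n) A)) [I.IsPrime]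
    (hI : I.comap MvPolynomial.C = ⊥) :
    ∃ c ∉ I, ∀ (k : Type) [Field k] (ψ : A →+* k) (h : MvPolynomial (Fin n) k),
      h ∈ (I.map (MvPolynomial.map ψ)).radical →
        ∃ M : ℕ, MvPolynomial.map ψ c ^ M * h ∈ I.map (MvPolynomial.map ψ) := by
  let B := MvPolynomial (Fin n) A ⧸ I
  have hinj : Function.Injective (algebraMap A B) := by
    rw [injective_iff_map_eq_zero]
    intro a ha
    have : a ∈ I.comap MvPolynomial.C :=
      Ideal.mem_comap.2 (Ideal.Quotient.eq_zero_iff_mem (I := I).1 ha)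
    simpa [hI] using this
  have : FaithfulSMul A B := (faithfulSMul_iff_algebraMap_injective A B).2 hinj
  have : Algebra.FinitePresentation A B := Algebra.FinitePresentation.of_finiteType.1 inferInstance
  obtain ⟨c', hc', hsm⟩ := Algebra.exists_isStandardSmooth_localizationAway A B
  obtain ⟨c, rfl⟩ := Ideal.Quotient.mk_surjective c'
  refine ⟨c, fun hc => hc' (Ideal.Quotient.eq_zero_iff_mem.2 hc), ?_⟩
  intro k _ ψ h hh
  let _ : Algebra A k := ψ.toAlgebra
  set J := I.map (MvPolynomial.map ψ) with hJ
  let Bc := Localization.Away (Ideal.Quotient.mk I c)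
  let Q := MvPolynomial (Fin n) k ⧸ J
  let Qc := Localization.Away (Ideal.Quotient.mk J (MvPolynomial.map ψ c))
  have : IsReduced (k ⊗[A] Bc) := Algebra.IsStandardSmooth.isReduced_of_field k _
  let g₁ : MvPolynomial (Fin n) k →ₐ[k] k ⊗[A] Bc :=
    MvPolynomial.aeval fun i => 1 ⊗ₜ algebraMap B Bc (Ideal.Quotient.mk I (MvPolynomial.X i))
  have hg₁ (f : MvPolynomial (Fin n) A) :
      g₁ (MvPolynomial.map ψ f) = 1 ⊗ₜ algebraMap B Bc (Ideal.Quotient.mk I f) := by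
    have : (g₁.restrictScalars A).comp (MvPolynomial.mapAlgHom (Algebra.ofId A k)) =
        (Algebra.TensorProduct.includeRight : Bc →ₐ[A] k ⊗[A] Bc).comp
          ((Algebra.algHom A B Bc).comp (Ideal.Quotient.mkₐ A I)) := by
      ext i; simp [g₁]; rfl
    exact DFunLike.congr_fun this f
  let β₀ : MvPolynomial (Fin n) A →ₐ[A] Qc :=
    MvPolynomial.aeval fun i => algebraMap Q Qc (Ideal.Quotient.mk J (MvPolynomial.X i))
  have hβ₀ (f : MvPolynomial (Fin n) A) :
      β₀ f = algebraMap Q Qc (Ideal.Quotient.mk J (MvPolynomial.map ψ f)) := by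
    have : (β₀ : MvPolynomial (Fin n) A →+* Qc) =
        ((algebraMap Q Qc).comp (Ideal.Quotient.mk J)).comp (MvPolynomial.map ψ) := by
      refine MvPolynomial.ringHom_ext (fun a => ?_) fun i => by simp [β₀]
      simp only [RingHom.coe_coe, RingHom.comp_apply, MvPolynomial.map_C]
      exact MvPolynomial.algHom_C β₀ a
    exact DFunLike.congr_fun this f
  let β₁ : B →ₐ[A] Qc := Ideal.Quotient.liftₐ I β₀ fun f hf => by
    rw [hβ₀, Ideal.Quotient.eq_zero_iff_mem.2 (Ideal.mem_map_of_mem _ hf), map_zero]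
  have hβ₁ (f : MvPolynomial (Fin n) A) : β₁ (Ideal.Quotient.mk I f) =
      algebraMap Q Qc (Ideal.Quotient.mk J (MvPolynomial.map ψ f)) := hβ₀ f
  let β : Bc →ₐ[A] Qc := IsLocalization.liftAlgHom (M := Submonoid.powers (Ideal.Quotient.mk I c))
    (f := β₁) (by
      rintro ⟨_, m, rfl⟩
      simp only [map_pow]
      rw [hβ₁]
      exact (IsLocalization.Away.algebraMap_isUnit _).pow m)
  let g₂ : k ⊗[A] Bc →ₐ[k] Qc :=
    Algebra.TensorProduct.lift (Algebra.ofId k Qc) β fun _ _ => Commute.all _ _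
  -- The localization map factors through the reduced ring `k ⊗[A] Bc`.
  have hg₂ : g₂.comp g₁ = (Algebra.algHom k Q Qc).comp (Ideal.Quotient.mkₐ k J) := by
    ext i
    have : β (algebraMap B Bc (Ideal.Quotient.mk I (MvPolynomial.X i))) =
        algebraMap Q Qc (Ideal.Quotient.mk J (MvPolynomial.X i)) := by
      rw [← MvPolynomial.map_X ψ i, ← hβ₁]
      exact IsLocalization.lift_eq _ _
    simp [g₁, g₂, this]
    rfl
  obtain ⟨N, hN⟩ := hh
  have h0 : g₁ h = 0 := by
    have hle : J ≤ RingHom.ker g₁ := by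
      rw [hJ, Ideal.map_le_iff_le_comap]
      intro f hf
      change g₁ (MvPolynomial.map ψ f) = 0
      rw [hg₁, Ideal.Quotient.eq_zero_iff_mem.2 hf, map_zero, TensorProduct.tmul_zero]
    have := hle hN
    rw [RingHom.mem_ker, map_pow] at this
    exact IsNilpotent.eq_zero ⟨N, this⟩
  have h1 : algebraMap Q Qc (Ideal.Quotient.mk J h) = 0 := by
    have := DFunLike.congr_fun hg₂ h
    simp only [AlgHom.comp_apply, h0, map_zero] at this
    exact this.symm
  obtain ⟨⟨_, M, rfl⟩, hM⟩ := (IsLocalization.map_eq_zero_iff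
    (Submonoid.powers (Ideal.Quotient.mk J (MvPolynomial.map ψ c))) Qc _).1 h1
  refine ⟨M, Ideal.Quotient.eq_zero_iff_mem.1 ?_⟩
  simpa using hM

/-! ### Monomial complements of ideals and the affine Hilbert function -/

open MvPolynomial in
theorem MvPolynomial.exists_map_eq_support_subset {σ A B : Type*} [CommRing A] [CommRing B]
    {φ : A →+* B} (hφ : Function.Surjective φ) (p : MvPolynomial σ B) :
    ∃ q : MvPolynomial σ A, map φ q = p ∧ q.support ⊆ p.support := by
  classical
  choose g hg using hφ
  refine ⟨∑ e ∈ p.support, monomial e (g (p.coeff e)), ?_, ?_⟩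
  · simp [map_sum, hg, ← p.as_sum]
  · intro e he
    obtain ⟨a, ha, h⟩ := Finset.mem_biUnion.1 (support_sum he)
    have := support_monomial_subset h
    rw [Finset.mem_singleton] at this
    exact this ▸ ha

/-- The monomials with exponent in `M` span a complement of the ideal `𝔞`, and the component along
this complement does not exceed the polynomial in total degree. -/
structure IsMonomialComplement {A : Type*} [CommRing A] {n : ℕ}
    (𝔞 : Ideal (MvPolynomial (Fin n) A)) (M : Set (Fin n →₀ ℕ)) : Prop where
  exists_add : ∀ h : MvPolynomial (Fin n) A, ∃ i ∈ 𝔞, ∃ r ∈ MvPolynomial.restrictSupport A M,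
    h = i + r ∧ r.totalDegree ≤ h.totalDegree
  eq_zero : ∀ r ∈ MvPolynomial.restrictSupport A M, r ∈ 𝔞 → r = 0

namespace IsMonomialComplement

open MvPolynomial

section

variable {A : Type*} [CommRing A] {n : ℕ} {𝔞 : Ideal (MvPolynomial (Fin n) A)}
  {M : Set (Fin n →₀ ℕ)}

theorem exists_add_of_mem_map_C (h : IsMonomialComplement 𝔞 M) (P : Ideal A)
    {y : MvPolynomial (Fin n) A} (hy : y ∈ P.map C) :
    ∃ i ∈ P.map C * 𝔞, ∃ r ∈ restrictSupport A M, r ∈ P.map (C : A →+* MvPolynomial (Fin n) A) ∧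
      y = i + r := by
  choose i hi r hr hir _ using fun e : Fin n →₀ ℕ => h.exists_add (monomial e 1)
  have hP (e : Fin n →₀ ℕ) : C (y.coeff e) ∈ P.map (C : A →+* MvPolynomial (Fin n) A) :=
    Ideal.mem_map_of_mem _ (mem_map_C_iff.1 hy e)
  refine ⟨∑ e ∈ y.support, C (y.coeff e) * i e,
    Ideal.sum_mem _ fun e _ => Ideal.mul_mem_mul (hP e) (hi e),
    ∑ e ∈ y.support, C (y.coeff e) * r e,
    Submodule.sum_mem _ fun e _ => ?_, Ideal.sum_mem _ fun e _ => Ideal.mul_mem_right _ _ (hP e),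
    ?_⟩
  · rw [← smul_eq_C_mul]
    exact Submodule.smul_mem _ _ (hr e)
  · rw [← Finset.sum_add_distrib]
    conv_lhs => rw [y.as_sum]
    refine Finset.sum_congr rfl fun e _ => ?_
    rw [← mul_add, ← hir, C_mul_monomial, mul_one]

/-- The quotient by `𝔞` is free, hence flat: `P` times the polynomial ring meets `𝔞` in `P𝔞`. -/
theorem mem_map_C_mul (h : IsMonomialComplement 𝔞 M) (P : Ideal A)
    {y : MvPolynomial (Fin n) A} (hy : y ∈ P.map C) (hya : y ∈ 𝔞) : y ∈ P.map C * 𝔞 := by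
  obtain ⟨i, hi, r, hr, -, rfl⟩ := h.exists_add_of_mem_map_C P hy
  have := h.eq_zero r hr ((Ideal.add_mem_iff_right _ (Ideal.mul_le_right hi)).1 hya)
  rwa [this, add_zero]

/-- Monomial complements persist along surjections of the coefficient ring: the quotient by `𝔞` is
free on the monomials with exponent in `M`, and its base change is the quotient by the image. -/
protected theorem map (h : IsMonomialComplement 𝔞 M) {B : Type*} [CommRing B] {φ : A →+* B}
    (hφ : Function.Surjective φ) : IsMonomialComplement (𝔞.map (map φ)) M := by
  refine ⟨fun p => ?_, fun r hr hra => ?_⟩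
  · obtain ⟨q, rfl, hq⟩ := exists_map_eq_support_subset hφ p
    obtain ⟨i, hi, r, hr, rfl, hdeg⟩ := h.exists_add q
    refine ⟨map φ i, Ideal.mem_map_of_mem _ hi, map φ r, ?_, map_add _ _ _, ?_⟩
    · rw [mem_restrictSupport_iff] at hr ⊢
      exact (Finset.coe_subset.2 (support_map_subset _ _)).trans hr
    · exact (Finset.sup_mono (support_map_subset _ _)).trans (hdeg.trans (Finset.sup_mono hq))
  · obtain ⟨q, rfl, hq⟩ := exists_map_eq_support_subset hφ r
    obtain ⟨a, ha, haq⟩ := (Ideal.mem_map_iff_of_surjective _ (map_surjective φ hφ)).1 hra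
    have hker : q - a ∈ (RingHom.ker φ).map (C : A →+* MvPolynomial (Fin n) A) := by
      rw [← ker_map, RingHom.mem_ker, map_sub, haq, sub_self]
    obtain ⟨i, hi, r, hr', hrP, hqr⟩ := h.exists_add_of_mem_map_C _ hker
    have hq' : q ∈ restrictSupport A M := by
      rw [mem_restrictSupport_iff] at hr ⊢
      exact (Finset.coe_subset.2 hq).trans hr
    have h0 := h.eq_zero (q - r) (Submodule.sub_mem _ hq' hr') (by
      rw [show q - r = a + i by linear_combination hqr]
      exact 𝔞.add_mem ha (Ideal.mul_le_right hi))
    rw [sub_eq_zero.1 h0, ← RingHom.mem_ker, ker_map]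
    exact hrP

end

theorem affineHilbertFunction_eq {k : Type*} [Field k] {n : ℕ}
    {𝔞 : Ideal (MvPolynomial (Fin n) k)} {M : Set (Fin n →₀ ℕ)} (h : IsMonomialComplement 𝔞 M)
    (i : ℤ) :
    affineHilbertFunction 𝔞 i = Nat.card ↥(M ∩ {e : Fin n →₀ ℕ | (e.degree : ℤ) ≤ i}) := by
  set D : Set (Fin n →₀ ℕ) := {e | (e.degree : ℤ) ≤ i} with hD
  have hle : restrictSupport k (M ∩ D) ≤ polysOfDegreeLE k n i :=
    restrictSupport_mono _ Set.inter_subset_right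
  let N := (𝔞.restrictScalars k).submoduleOf (polysOfDegreeLE k n i)
  let g : restrictSupport k (M ∩ D) →ₗ[k] polysOfDegreeLE k n i ⧸ N :=
    N.mkQ.comp (Submodule.inclusion hle)
  have hinj : Function.Injective g := by
    rw [injective_iff_map_eq_zero]
    rintro ⟨r, hr⟩ h0
    have hra : r ∈ 𝔞 := (Submodule.Quotient.mk_eq_zero N).1 h0
    exact Subtype.ext
      (h.eq_zero r (restrictSupport_mono _ Set.inter_subset_left hr) hra)
  have hsurj : Function.Surjective g := by
    intro x
    obtain ⟨⟨p, hp⟩, rfl⟩ := N.mkQ_surjective x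
    obtain ⟨a, ha, r, hr, hpr, hdeg⟩ := h.exists_add p
    have hrD : r ∈ restrictSupport k (M ∩ D) := by
      rw [mem_restrictSupport_iff] at hr ⊢
      refine Set.subset_inter hr fun e he => ?_
      -- The zero polynomial has total degree `0`, which exceeds a negative `i`.
      have hp0 : p.support.Nonempty := by
        rw [Finset.nonempty_iff_ne_empty, Ne, support_eq_empty]
        rintro rfl
        have : r = 0 := h.eq_zero r ((mem_restrictSupport_iff _).2 hr) (by
          rw [← neg_eq_of_add_eq_zero_right hpr.symm]
          exact 𝔞.neg_mem ha)
        simp [this] at he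
      have hpD : ∀ e ∈ p.support, (e.degree : ℤ) ≤ i := fun e he => hp he
      obtain ⟨e₀, he₀⟩ := hp0
      lift i to ℕ using (Int.natCast_nonneg _).trans (hpD e₀ he₀)
      have hpi : p.totalDegree ≤ i := Finset.sup_le fun e he => by exact_mod_cast hpD e he
      have := (le_totalDegree (show e ∈ r.support from he)).trans (hdeg.trans hpi)
      exact Int.ofNat_le.2 this
    refine ⟨⟨r, hrD⟩, ?_⟩
    refine ((Submodule.Quotient.eq N).2 ?_)
    change r - p ∈ 𝔞
    rw [hpr, sub_add_cancel_right]
    exact 𝔞.neg_mem ha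
  rw [affineHilbertFunction, ← (LinearEquiv.ofBijective g ⟨hinj, hsurj⟩).finrank_eq,
    Module.finrank_eq_nat_card_basis (basisRestrictSupport k (M ∩ D))]

end IsMonomialComplement

/-! ### Gröbner bases for the degree lexicographic order -/

section LeadingExponents

open MvPolynomial MonomialOrder

/-- The exponents of the leading monomials of the nonzero elements of `𝔟`, for the degree
lexicographic order. -/
def leadingExponents {A : Type*} [CommRing A] {n : ℕ} (𝔟 : Ideal (MvPolynomial (Fin n) A)) :
    Set (Fin n →₀ ℕ) :=
  {e | ∃ g ∈ 𝔟, g ≠ 0 ∧ degLex.degree g = e}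

variable {K : Type*} [Field K] {n : ℕ} (𝔟 : Ideal (MvPolynomial (Fin n) K))

/-- A finite Gröbner basis of monic polynomials. Finiteness comes from Dickson's lemma. -/
theorem exists_finite_monic_forall_degree_le :
    ∃ G : Set (MvPolynomial (Fin n) K), G.Finite ∧ (∀ g ∈ G, g ∈ 𝔟 ∧ degLex.Monic g) ∧
      ∀ e ∈ leadingExponents 𝔟, ∃ g ∈ G, degLex.degree g ≤ e := by
  have hmonic : ∀ e ∈ leadingExponents 𝔟, ∃ g ∈ 𝔟, degLex.Monic g ∧ degLex.degree g = e := by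
    rintro _ ⟨g, hg, hg0, rfl⟩
    have hu := (degLex.leadingCoeff_ne_zero_iff (f := g)).2 hg0
    refine ⟨C (degLex.leadingCoeff g)⁻¹ * g, 𝔟.mul_mem_left _ hg, ?_, ?_⟩
    · rw [Monic, leadingCoeff_mul, leadingCoeff_C, inv_mul_cancel₀ hu]
    · rw [degree_mul (by simpa using hg0) hg0, degree_C, zero_add]
  choose! g hgb hgm hgd using hmonic
  let S : Set (Fin n →₀ ℕ) := {e | Minimal (· ∈ leadingExponents 𝔟) e}
  have hS : S.Finite := WellQuasiOrderedLE.finite_of_isAntichain (setOfPred_minimal_antichain _)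
  refine ⟨g '' S, hS.image g, ?_, fun e he => ?_⟩
  · rintro _ ⟨e, he, rfl⟩
    exact ⟨hgb e he.prop, hgm e he.prop⟩
  · obtain ⟨e', hle, he'⟩ := exists_minimal_le_of_wellFoundedLT (· ∈ leadingExponents 𝔟) e he
    exact ⟨g e', ⟨e', he', rfl⟩, (hgd e' he'.prop).trans_le hle⟩

/-- Division with remainder by a Gröbner basis whose elements are defined and monic over a
subring of `K`. -/
theorem exists_add_of_monic {A : Type*} [CommRing A] {ι : A →+* K} (hι : Function.Injective ι)
    {G : Set (MvPolynomial (Fin n) A)} (hG : ∀ g ∈ G, degLex.Monic (map ι g))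
    (hGb : ∀ e ∈ leadingExponents 𝔟, ∃ g ∈ G, degLex.degree (map ι g) ≤ e)
    (h : MvPolynomial (Fin n) A) :
    ∃ i ∈ Ideal.span G, ∃ r ∈ restrictSupport A (leadingExponents 𝔟)ᶜ,
      h = i + r ∧ r.totalDegree ≤ h.totalDegree := by
  have hdeg (p : MvPolynomial (Fin n) A) : degLex.degree (map ι p) = degLex.degree p := by
    simp only [MonomialOrder.degree, support_map_of_injective p hι]
  have hu : ∀ g ∈ G, IsUnit (degLex.leadingCoeff g) := by
    intro g hg
    have h1 : ι (degLex.leadingCoeff g) = 1 := by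
      have := hG g hg
      rwa [Monic, leadingCoeff, hdeg, coeff_map] at this
    rw [(hι (h1.trans ι.map_one.symm) : degLex.leadingCoeff g = 1)]
    exact isUnit_one
  obtain ⟨q, r, hqr, hq, hr⟩ := degLex.div_set hu h
  have hi : Finsupp.linearCombination _ (fun b : G => (b : MvPolynomial (Fin n) A)) q ∈
      Ideal.span G := by
    rw [Finsupp.linearCombination_apply]
    exact Ideal.sum_mem _ fun b _ => Ideal.mul_mem_left _ _ (Ideal.subset_span b.2)
  refine ⟨_, hi, r, ?_, hqr, ?_⟩
  · rw [mem_restrictSupport_iff]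
    intro e he hel
    obtain ⟨g, hg, hge⟩ := hGb e hel
    exact hr e he g hg (hdeg g ▸ hge)
  · refine degLex_totalDegree_monotone ?_
    rw [← sub_eq_iff_eq_add'.2 hqr]
    refine degree_sub_le.trans (sup_le le_rfl ?_)
    rw [Finsupp.linearCombination_apply, Finsupp.sum]
    refine degree_sum_le.trans (Finset.sup_le fun b _ => ?_)
    simpa [mul_comm] using hq b

theorem eq_zero_of_mem_restrictSupport {A : Type*} [CommRing A] {ι : A →+* K}
    (hι : Function.Injective ι) {r : MvPolynomial (Fin n) A}
    (hr : r ∈ restrictSupport A (leadingExponents 𝔟)ᶜ) (hrb : map ι r ∈ 𝔟) : r = 0 := by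
  by_contra h0
  have h1 : map ι r ≠ 0 := fun h => h0 (map_injective ι hι (h.trans (map_zero _).symm))
  have := degree_mem_support (m := degLex) h1
  rw [support_map_of_injective r hι] at this
  exact hr this ⟨_, hrb, h1, rfl⟩

theorem isMonomialComplement_leadingExponents :
    IsMonomialComplement 𝔟 (leadingExponents 𝔟)ᶜ := by
  obtain ⟨G, -, hG, hGb⟩ := exists_finite_monic_forall_degree_le 𝔟
  refine ⟨fun h => ?_, fun r hr hrb => eq_zero_of_mem_restrictSupport 𝔟
    (ι := RingHom.id K) Function.injective_id hr (by rwa [map_id])⟩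
  obtain ⟨i, hi, r, hr, h'⟩ := exists_add_of_monic 𝔟 (ι := RingHom.id K) Function.injective_id
    (G := G) (fun g hg => by rw [map_id]; exact (hG g hg).2) (by simpa only [map_id] using! hGb) h
  exact ⟨i, Ideal.span_le.2 (fun g hg => (hG g hg).1) hi, r, hr, h'⟩

end LeadingExponents

/-! ### Specializations of a field -/

/-- A specialization of a field `K`: a subring of `K` together with a ring homomorphism of it
onto a field. The domain need not be local; the residue field is kept in `Type`, where the fields
`ZMod p` live. -/
structure FieldSpecialization (K : Type*) [Field K] where
  /-- The subring on which the specialization is defined. -/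
  dom : Subring K
  /-- The field in which the specialization takes its values. -/
  resField : Type
  [field : Field resField]
  /-- The homomorphism from the domain onto the residue field. -/
  toHom : dom →+* resField
  surjective : Function.Surjective toHom

namespace FieldSpecialization

attribute [instance] FieldSpecialization.field

open MvPolynomial Filter

variable {K : Type*} [Field K] {n : ℕ}

/-- A property holds for generic specializations if it holds for those that are defined at each of
finitely many given elements of `K`. -/
def generic (K : Type*) [Field K] : Filter (FieldSpecialization K) := ⨅ x : K, 𝓟 {v | x ∈ v.dom}

/-- The polynomials with coefficients in the domain of `v`, as polynomials over `K`. -/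
noncomputable def incl (v : FieldSpecialization K) (n : ℕ) :
    MvPolynomial (Fin n) v.dom →+* MvPolynomial (Fin n) K :=
  map v.dom.subtype

/-- FieldSpecialization of the coefficients. -/
noncomputable def spec (v : FieldSpecialization K) (n : ℕ) :
    MvPolynomial (Fin n) v.dom →+* MvPolynomial (Fin n) v.resField :=
  map v.toHom

theorem incl_injective (v : FieldSpecialization K) : Function.Injective (v.incl n) :=
  map_injective _ Subtype.val_injective

theorem spec_surjective (v : FieldSpecialization K) : Function.Surjective (v.spec n) :=
  map_surjective _ v.surjective

/-- The contraction of `𝔟` to the polynomials with coefficients in the domain of `v`. -/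
noncomputable def contr (v : FieldSpecialization K) (𝔟 : Ideal (MvPolynomial (Fin n) K)) :
    Ideal (MvPolynomial (Fin n) v.dom) :=
  𝔟.comap (v.incl n)

/-- The specialization of the ideal `𝔟`: all specializations of its elements. -/
noncomputable def specIdeal (v : FieldSpecialization K) (𝔟 : Ideal (MvPolynomial (Fin n) K)) :
    Ideal (MvPolynomial (Fin n) v.resField) :=
  (v.contr 𝔟).map (v.spec n)

theorem eventually_mem_dom (x : K) : ∀ᶠ v in generic K, x ∈ v.dom :=
  mem_iInf_of_mem x (mem_principal_self _)

theorem eventually_exists_incl_eq (p : MvPolynomial (Fin n) K) :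
    ∀ᶠ v in generic K, ∃ q, v.incl n q = p := by
  induction p using MvPolynomial.induction_on with
  | C a =>
    filter_upwards [eventually_mem_dom a] with v hv
    exact ⟨C ⟨a, hv⟩, by simp [incl]⟩
  | add p q hp hq =>
    filter_upwards [hp, hq] with v ⟨p', hp⟩ ⟨q', hq⟩
    exact ⟨p' + q', by rw [map_add, hp, hq]⟩
  | mul_X p i hp =>
    filter_upwards [hp] with v ⟨p', hp⟩
    exact ⟨p' * X i, by rw [map_mul, hp]; simp [incl]⟩

/-- A representation of an element of an ideal by generators has finitely many coefficients, so it
is defined over the domain of a generic specialization. -/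
theorem eventually_exists_mem_span {T : Set (MvPolynomial (Fin n) K)}
    {p : MvPolynomial (Fin n) K} (hp : p ∈ Ideal.span T) :
    ∀ᶠ v in generic K, ∃ q ∈ Ideal.span (v.incl n ⁻¹' T), v.incl n q = p := by
  induction hp using Submodule.span_induction with
  | mem p hp =>
    filter_upwards [eventually_exists_incl_eq p] with v ⟨q, hq⟩
    exact ⟨q, Ideal.subset_span (by rwa [Set.mem_preimage, hq]), hq⟩
  | zero => exact .of_forall fun v => ⟨0, zero_mem _, map_zero _⟩
  | add p q _ _ hp hq =>
    filter_upwards [hp, hq] with v ⟨p', hp', hp⟩ ⟨q', hq', hq⟩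
    exact ⟨p' + q', add_mem hp' hq', by rw [map_add, hp, hq]⟩
  | smul a p _ hp =>
    filter_upwards [eventually_exists_incl_eq a, hp] with v ⟨a', ha⟩ ⟨p', hp', hp⟩
    exact ⟨a' * p', Ideal.mul_mem_left _ _ hp', by rw [map_mul, ha, hp, smul_eq_mul]⟩

/-- Generically, a monic Gröbner basis of the ideal generated by `T` is defined over the domain and
generated there by the elements of `T`, and division by it yields the decomposition. -/
theorem eventually_exists_add (T : Set (MvPolynomial (Fin n) K)) :
    ∀ᶠ v : FieldSpecialization K in generic K, ∀ h : MvPolynomial (Fin n) v.dom,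
      ∃ i ∈ Ideal.span (v.incl n ⁻¹' T),
      ∃ r ∈ restrictSupport v.dom (leadingExponents (Ideal.span T))ᶜ,
        h = i + r ∧ r.totalDegree ≤ h.totalDegree := by
  obtain ⟨G, hGfin, hG, hGb⟩ := exists_finite_monic_forall_degree_le (Ideal.span T)
  have := (eventually_all_finite hGfin).2 fun g hg => eventually_exists_mem_span (hG g hg).1
  filter_upwards [this] with v hv h
  obtain ⟨i, hi, h'⟩ := exists_add_of_monic (Ideal.span T) (ι := v.dom.subtype)
    Subtype.val_injective (G := v.incl n ⁻¹' G) (fun g hg => (hG _ hg).2) (fun e he => by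
      obtain ⟨g, hg, hge⟩ := hGb e he
      obtain ⟨q, -, rfl⟩ := hv g hg
      exact ⟨q, hg, hge⟩) h
  refine ⟨i, Ideal.span_le.2 (fun g hg => ?_) hi, h'⟩
  obtain ⟨q, hq, hqg⟩ := hv _ hg
  rwa [← v.incl_injective hqg]

theorem span_preimage_le_contr (v : FieldSpecialization K) (T : Set (MvPolynomial (Fin n) K)) :
    Ideal.span (v.incl n ⁻¹' T) ≤ v.contr (Ideal.span T) :=
  Ideal.span_le.2 fun _ hg => Ideal.mem_comap.2 (Ideal.subset_span hg)

theorem eventually_isMonomialComplement_contr (𝔟 : Ideal (MvPolynomial (Fin n) K)) :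
    ∀ᶠ v in generic K, IsMonomialComplement (v.contr 𝔟) (leadingExponents 𝔟)ᶜ := by
  filter_upwards [eventually_exists_add (𝔟 : Set (MvPolynomial (Fin n) K))] with v hv
  rw [Ideal.span_eq] at hv
  refine ⟨fun h => ?_, fun r hr hrb => eq_zero_of_mem_restrictSupport 𝔟
    (ι := v.dom.subtype) Subtype.val_injective hr hrb⟩
  obtain ⟨i, hi, h'⟩ := hv h
  exact ⟨i, (Ideal.span_le (I := v.contr 𝔟)).2 (fun _ hg => hg) hi, h'⟩

/-- For a generic specialization, specializing an ideal amounts to specializing generators. -/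
theorem eventually_contr_span_eq (T : Set (MvPolynomial (Fin n) K)) :
    ∀ᶠ v in generic K, v.contr (Ideal.span T) = Ideal.span (v.incl n ⁻¹' T) := by
  filter_upwards [eventually_exists_add T] with v hv
  refine le_antisymm (fun h hh => ?_) (v.span_preimage_le_contr T)
  obtain ⟨i, hi, r, hr, rfl, -⟩ := hv h
  have h0 := eq_zero_of_mem_restrictSupport (Ideal.span T) (ι := v.dom.subtype)
    Subtype.val_injective hr ((Ideal.add_mem_iff_right _ (v.span_preimage_le_contr T hi)).1 hh)
  rwa [h0, add_zero]

theorem eventually_affineHilbertFunction_eq (𝔟 : Ideal (MvPolynomial (Fin n) K)) :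
    ∀ᶠ v in generic K, affineHilbertFunction (v.specIdeal 𝔟) = affineHilbertFunction 𝔟 := by
  filter_upwards [eventually_isMonomialComplement_contr 𝔟] with v hv
  funext i
  rw [(isMonomialComplement_leadingExponents 𝔟).affineHilbertFunction_eq]
  exact (hv.map v.surjective).affineHilbertFunction_eq i

/-- Non-zero-divisors modulo `𝔟` specialize to non-zero-divisors: the quotient by `𝔟 + (c)` is
flat over the domain of a generic specialization. -/
theorem eventually_mem_specIdeal_of_mul_mem {𝔟 : Ideal (MvPolynomial (Fin n) K)}
    {c : MvPolynomial (Fin n) K} (hc : ∀ h, c * h ∈ 𝔟 → h ∈ 𝔟) :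
    ∀ᶠ v in generic K, ∀ c', v.incl n c' = c → ∀ h, v.spec n c' * h ∈ v.specIdeal 𝔟 →
      h ∈ v.specIdeal 𝔟 := by
  filter_upwards [eventually_isMonomialComplement_contr
      (Ideal.span (insert c (𝔟 : Set (MvPolynomial (Fin n) K)))),
    eventually_contr_span_eq (insert c (𝔟 : Set (MvPolynomial (Fin n) K)))] with v hv hspan
  rintro c' rfl h hh
  have hpre : v.incl n ⁻¹' insert (v.incl n c') (𝔟 : Set (MvPolynomial (Fin n) K)) =
      insert c' (v.contr 𝔟 : Set (MvPolynomial (Fin n) v.dom)) := by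
    ext g; simp [contr, v.incl_injective.eq_iff]
  obtain ⟨h, rfl⟩ := v.spec_surjective h
  obtain ⟨b, hb, hbh⟩ := (Ideal.mem_map_iff_of_surjective _ v.spec_surjective).1 hh
  have hker : RingHom.ker (v.spec n) = (RingHom.ker v.toHom).map C := ker_map _
  have hy : c' * h - b ∈ (RingHom.ker v.toHom).map C := by
    rw [← hker, RingHom.mem_ker, map_sub, map_mul, hbh, sub_self]
  have hyJ : c' * h - b ∈ Ideal.span (insert c' (v.contr 𝔟 : Set (MvPolynomial (Fin n) v.dom))) :=
    sub_mem (Ideal.mul_mem_right _ _ (Ideal.subset_span (Set.mem_insert _ _)))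
      (Ideal.subset_span (Set.mem_insert_of_mem _ hb))
  have := hv.mem_map_C_mul (RingHom.ker v.toHom) hy (by rwa [hspan, hpre])
  -- Splitting `P(𝔟 + (c))` as `P𝔟 + Pc` corrects `h` by some `q` that specializes to zero.
  rw [hspan, hpre, Ideal.span_insert, Ideal.span_eq, Ideal.mul_sup, Submodule.mem_sup] at this
  obtain ⟨y, hy, z, hz, hyz⟩ := this
  obtain ⟨q, hq, rfl⟩ := Ideal.mem_mul_span_singleton.1 hy
  have hmem : h - q ∈ v.contr 𝔟 := by
    refine hc _ ?_
    rw [← map_mul]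
    change c' * (h - q) ∈ v.contr 𝔟
    rw [show c' * (h - q) = b + z by linear_combination -hyz]
    exact add_mem hb (Ideal.mul_le_right hz)
  have hq0 : v.spec n q = 0 := by rwa [← RingHom.mem_ker, hker]
  have := Ideal.mem_map_of_mem (v.spec n) hmem
  rwa [map_sub, hq0, sub_zero] at this

theorem radical_specIdeal_radical (v : FieldSpecialization K) (𝔞 : Ideal (MvPolynomial (Fin n) K)) :
    (v.specIdeal 𝔞.radical).radical = (v.specIdeal 𝔞).radical := by
  refine le_antisymm ?_ (Ideal.radical_mono
    (Ideal.map_mono (Ideal.comap_mono Ideal.le_radical)))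
  rw [Ideal.radical_le_radical_iff, specIdeal, contr, Ideal.comap_radical]
  exact Ideal.map_radical_le _

end FieldSpecialization

namespace FieldSpecialization

open MvPolynomial
open Filter hiding map map_map

/-! ### Specializations over a base ring -/

section Base

variable {A K : Type*} [CommRing A] [Field K] [Algebra A K] {n : ℕ}

theorem eventually_specIdeal_span_image_eq (T : Set (MvPolynomial (Fin n) A)) :
    ∀ᶠ v : FieldSpecialization K in generic K, ∀ j : A →+* v.dom,
      v.dom.subtype.comp j = algebraMap A K →
        v.specIdeal (Ideal.span (map (algebraMap A K) '' T)) =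
          Ideal.span (map (v.toHom.comp j) '' T) := by
  filter_upwards [eventually_contr_span_eq (map (algebraMap A K) '' T)] with v hv j hj
  have hpre : v.incl n ⁻¹' (map (algebraMap A K) '' T) = map j '' T := by
    rw [← v.incl_injective.preimage_image (map j '' T), Set.image_image]
    simp only [incl, map_map, hj]
  rw [specIdeal, hv, hpre, Ideal.map_span, Set.image_image]
  simp only [spec, map_map]

/-- Prime ideals specialize to radical ideals: the coordinate ring of the prime ideal is smooth
over `A` outside the zero locus of some `c`, so the specialized ideal is radical outside the zero
locus of the specialization of `c`, which is a non-zero-divisor. -/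
theorem eventually_isRadical_specIdeal [IsDomain A] [IsNoetherianRing A] [CharZero A]
    [IsFractionRing A K] (𝔟 : Ideal (MvPolynomial (Fin n) K)) [𝔟.IsPrime] :
    ∀ᶠ v : FieldSpecialization K in generic K, ∀ j : A →+* v.dom,
      v.dom.subtype.comp j = algebraMap A K → (v.specIdeal 𝔟).IsRadical := by
  set I : Ideal (MvPolynomial (Fin n) A) := 𝔟.comap (map (algebraMap A K)) with hI
  have hIC : I.comap C = ⊥ := by
    rw [eq_bot_iff]
    intro a ha
    by_contra h0
    have hmem : C (algebraMap A K a) ∈ 𝔟 := by simpa [hI] using ha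
    refine Ideal.IsPrime.ne_top ‹_› (Ideal.eq_top_of_isUnit_mem _ hmem ?_)
    exact (IsUnit.mk0 _ (by simpa using h0)).map C
  have hspan : I.map (map (algebraMap A K)) = 𝔟 := by
    let _ : Algebra (MvPolynomial (Fin n) A) (MvPolynomial (Fin n) K) := algebraMvPolynomial
    have := isLocalization (σ := Fin n) (nonZeroDivisors A) K
    rw [hI, ← algebraMap_def]
    exact IsLocalization.map_under ((nonZeroDivisors A).map (C : A →+* MvPolynomial (Fin n) A))
      (MvPolynomial (Fin n) K) 𝔟
  obtain ⟨c, hcI, hc⟩ := I.exists_pow_mul_mem_map_of_mem_radical hIC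
  have hc𝔟 : ∀ h, map (algebraMap A K) c * h ∈ 𝔟 → h ∈ 𝔟 := fun h hh =>
    (Ideal.IsPrime.mem_or_mem ‹_› hh).resolve_left hcI
  filter_upwards [eventually_specIdeal_span_image_eq (K := K) (I : Set (MvPolynomial (Fin n) A)),
    eventually_mem_specIdeal_of_mul_mem hc𝔟] with v hv hvc j hj h hh
  have hspec : v.specIdeal 𝔟 = I.map (map (v.toHom.comp j)) := by
    rw [Ideal.map, ← hv j hj, ← hspan, Ideal.map]
  rw [hspec] at hh
  obtain ⟨M, hM⟩ := hc _ _ h hh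
  rw [← hspec] at hM
  have hcancel : ∀ h, map (v.toHom.comp j) c * h ∈ v.specIdeal 𝔟 → h ∈ v.specIdeal 𝔟 := by
    intro h hh
    refine hvc (map j c) (by rw [incl, map_map, hj]) h ?_
    rwa [spec, map_map]
  clear hh
  induction M with
  | zero => simpa using hM
  | succ M ih =>
    rw [pow_succ', mul_assoc] at hM
    exact ih (hcancel _ hM)

end Base

/-! ### Specializations at prime numbers -/

section OfRingHom

variable {A : Type*} (K : Type*) [CommRing A] [IsDomain A] [Field K] [Algebra A K]
  [IsFractionRing A K] {k : Type} [Field k] (ψ : A →+* k)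

theorem comap_nonZeroDivisors_le :
    (nonZeroDivisors k).comap ψ ≤ nonZeroDivisors A := fun a ha =>
  mem_nonZeroDivisors_of_ne_zero fun h0 =>
    nonZeroDivisors.ne_zero (Submonoid.mem_comap.1 ha) (by rw [h0, map_zero])

/-- The localization of `A` at the kernel of `ψ`, inside the fraction field `K`. -/
noncomputable abbrev localSubalgebra : Subalgebra A K :=
  Localization.subalgebra.ofField K ((nonZeroDivisors k).comap ψ) (comap_nonZeroDivisors_le ψ)

/-- The extension of `ψ` to the localization of `A` at the kernel of `ψ`. -/
noncomputable def localLift : localSubalgebra K ψ →+* k :=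
  IsLocalization.lift (M := (nonZeroDivisors k).comap ψ) (g := ψ) fun a =>
    IsUnit.mk0 _ (nonZeroDivisors.ne_zero a.2)

theorem localLift_algebraMap (a : A) :
    localLift K ψ (algebraMap A (localSubalgebra K ψ) a) = ψ a :=
  IsLocalization.lift_eq _ a

/-- The specialization of the fraction field `K` of `A` that extends a homomorphism `ψ` from `A`
onto a field; it is defined on the localization of `A` at the kernel of `ψ`. -/
noncomputable def ofRingHom (hψ : Function.Surjective ψ) : FieldSpecialization K where
  dom := (localSubalgebra K ψ).toSubring
  resField := k
  toHom := localLift K ψ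
  surjective x := by
    obtain ⟨a, rfl⟩ := hψ x
    exact ⟨algebraMap A (localSubalgebra K ψ) a, localLift_algebraMap K ψ a⟩

/-- The structure homomorphism from `A` to the domain of the specialization given by `ψ`. -/
noncomputable def toDom (hψ : Function.Surjective ψ) : A →+* (ofRingHom K ψ hψ).dom :=
  algebraMap A (localSubalgebra K ψ)

theorem subtype_comp_toDom (hψ : Function.Surjective ψ) :
    (ofRingHom K ψ hψ).dom.subtype.comp (toDom K ψ hψ) = algebraMap A K := rfl

theorem toHom_comp_toDom (hψ : Function.Surjective ψ) :
    (ofRingHom K ψ hψ).toHom.comp (toDom K ψ hψ) = ψ :=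
  RingHom.ext fun a => localLift_algebraMap K ψ a

theorem mul_inv_mem_dom_ofRingHom (hψ : Function.Surjective ψ) (a b : A) (hb : ψ b ≠ 0) :
    algebraMap A K a * (algebraMap A K b)⁻¹ ∈ (ofRingHom K ψ hψ).dom :=
  ⟨a, b, mem_nonZeroDivisors_of_ne_zero hb, rfl⟩

end OfRingHom

/-- A nonzero element of a ring algebraic over `ℤ` divides a nonzero integer, so it is killed by
homomorphisms to `ZMod p` for finitely many primes `p` only. -/
theorem finite_setOf_exists_map_eq_zero {A : Type*} [CommRing A] [IsDomain A]
    [Algebra.IsAlgebraic ℤ A] {d : A} (hd : d ≠ 0) :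
    {p : ℕ | ∃ _ : Fact p.Prime, ∃ ψ : A →+* ZMod p, ψ d = 0}.Finite := by
  obtain ⟨N, hN, e, he⟩ := (Algebra.IsAlgebraic.isAlgebraic (R := ℤ) d).exists_nonzero_dvd
    (mem_nonZeroDivisors_of_ne_zero hd)
  refine (N.natAbs.divisors : Set ℕ).toFinite.subset ?_
  rintro p ⟨_, ψ, h⟩
  have hN0 : ((N : ℤ) : ZMod p) = 0 := by
    have := congrArg ψ he
    rwa [map_mul, h, zero_mul, eq_intCast, map_intCast] at this
  rw [ZMod.intCast_zmod_eq_zero_iff_dvd] at hN0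
  simpa [hN] using Int.natCast_dvd.1 hN0

/-- What holds for generic specializations holds for the specializations to `ZMod p` for all but
finitely many primes `p`. -/
theorem finite_setOf_exists_not_of_eventually {A : Type*} (K : Type*) [CommRing A] [IsDomain A]
    [Algebra.IsAlgebraic ℤ A] [Field K] [Algebra A K] [IsFractionRing A K]
    {P : FieldSpecialization K → Prop} (hP : ∀ᶠ v in generic K, P v) :
    {p : ℕ | ∃ _ : Fact p.Prime, ∃ ψ : A →+* ZMod p,
      ¬ P (ofRingHom K ψ (ZMod.ringHom_surjective ψ))}.Finite := by
  let g (x : Σ p : {p : ℕ // Fact p.Prime}, A →+* ZMod p) : FieldSpecialization K :=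
    haveI := x.1.2
    ofRingHom K x.2 (ZMod.ringHom_surjective x.2)
  have hg : Tendsto g (comap (fun x => (x.1 : ℕ)) cofinite) (generic K) := by
    refine tendsto_iInf.2 fun x => tendsto_principal.2 (eventually_comap.2 ?_)
    obtain ⟨a, b, hb, rfl⟩ := IsFractionRing.div_surjective (A := A) x
    refine (finite_setOf_exists_map_eq_zero (nonZeroDivisors.ne_zero hb)).subset fun p hp => ?_
    simp only [Set.mem_compl_iff, Set.mem_ofPred_eq, not_forall] at hp
    obtain ⟨⟨⟨p, hpf⟩, ψ⟩, rfl, hψ⟩ := hp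
    refine ⟨hpf, ψ, by_contra fun h => hψ ?_⟩
    rw [div_eq_mul_inv]
    exact mul_inv_mem_dom_ofRingHom K ψ (ZMod.ringHom_surjective ψ) a b h
  refine (eventually_comap.1 (hg.eventually hP)).subset ?_
  rintro p ⟨hpf, ψ, h⟩ h'
  exact h (h' ⟨⟨p, hpf⟩, ψ⟩ rfl)

end FieldSpecialization

/-! ### Reduction of the Hilbert function and of the multiplicity -/

section HilbertInvariants

variable {k k' : Type*} [Field k] [Field k'] {n : ℕ} {𝔞 : Ideal (MvPolynomial (Fin n) k)}
  {𝔟 : Ideal (MvPolynomial (Fin n) k')}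

theorem affineHilbertPolynomial_eq_of_affineHilbertFunction_eq
    (h : affineHilbertFunction 𝔞 = affineHilbertFunction 𝔟) :
    affineHilbertPolynomial 𝔞 = affineHilbertPolynomial 𝔟 := by
  have : IsAffineHilbertPolynomial 𝔞 = IsAffineHilbertPolynomial 𝔟 := by
    unfold IsAffineHilbertPolynomial
    rw [h]
  rw [affineHilbertPolynomial, affineHilbertPolynomial, this]

theorem hilbertDim_eq_of_affineHilbertFunction_eq
    (h : affineHilbertFunction 𝔞 = affineHilbertFunction 𝔟) : hilbertDim 𝔞 = hilbertDim 𝔟 := by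
  rw [hilbertDim, hilbertDim, affineHilbertPolynomial_eq_of_affineHilbertFunction_eq h]

theorem hilbertDegree_eq_of_affineHilbertFunction_eq
    (h : affineHilbertFunction 𝔞 = affineHilbertFunction 𝔟) :
    hilbertDegree 𝔞 = hilbertDegree 𝔟 := by
  rw [hilbertDegree, hilbertDegree, hilbertDim_eq_of_affineHilbertFunction_eq h,
    affineHilbertPolynomial_eq_of_affineHilbertFunction_eq h]

end HilbertInvariants

theorem isFractionRing_adjoin_int_singleton {L : Type*} [Field L] [CharZero L] {α : L}
    (hα : IntermediateField.adjoin ℚ {α} = ⊤) : IsFractionRing (Algebra.adjoin ℤ {α}) L := by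
  refine IsFractionRing.of_field _ _ fun z => ?_
  let E : IntermediateField ℚ L :=
    (Subfield.closure {α}).toIntermediateField fun q => by simp
  have hE : ⊤ ≤ E := by
    rw [← hα, IntermediateField.adjoin_le_iff, Set.singleton_subset_iff]
    exact Subfield.subset_closure (Set.mem_singleton α)
  have hz : z ∈ Subfield.closure {α} := hE (IntermediateField.mem_top (x := z))
  obtain ⟨x, hx, y, hy, rfl⟩ := Subfield.mem_closure_iff.1 hz
  have hadj : Subring.closure {α} = (Algebra.adjoin ℤ {α}).toSubring := by
    rw [Algebra.adjoin_int]; rfl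
  rw [hadj] at hx hy
  exact ⟨⟨x, hx⟩, ⟨y, hy⟩, rfl⟩

open MvPolynomial FieldSpecialization in
theorem mainTheorem2 {L : Type*} [Field L] [NumberField L] (α : L)
    (hα : IntermediateField.adjoin ℚ {α} = ⊤)
    {n s : ℕ} (𝔞 : Ideal (MvPolynomial (Fin n) L))
    (f : Fin s → MvPolynomial (Fin n) (Algebra.adjoin ℤ {α}))
    (hf : 𝔞 = Ideal.span
      (Set.range fun j => MvPolynomial.map (algebraMap (Algebra.adjoin ℤ {α}) L) (f j))) :
    {p : ℕ | ∃ _ : Fact p.Prime, ∃ ψ : Algebra.adjoin ℤ {α} →+* ZMod p,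
      ¬ (affineHilbertFunction (reducedIdeal ψ f) = affineHilbertFunction 𝔞 ∧
         hilbertDim (reducedIdeal ψ f) = hilbertDim 𝔞)}.Finite ∧
    ((∃ 𝔟 : Ideal (MvPolynomial (Fin n) L), IsPrimaryComponent 𝔞 𝔟) →
      {p : ℕ | ∃ _ : Fact p.Prime, ∃ ψ : Algebra.adjoin ℤ {α} →+* ZMod p,
        hilbertMultiplicity (reducedIdeal ψ f) ≠ hilbertMultiplicity 𝔞}.Finite) := by
  have := isFractionRing_adjoin_int_singleton hα
  have : Algebra.FiniteType ℤ (Algebra.adjoin ℤ {α}) :=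
    .adjoin_of_finite (Set.finite_singleton α)
  have : IsNoetherianRing (Algebra.adjoin ℤ {α}) := Algebra.FiniteType.isNoetherianRing ℤ _
  have : Algebra.IsAlgebraic ℤ L := (IsFractionRing.comap_isAlgebraic_iff (A := ℤ) (K := ℚ)).2
    inferInstance
  have : Algebra.IsAlgebraic ℤ (Algebra.adjoin ℤ {α}) :=
    .of_injective (Algebra.adjoin ℤ {α}).val Subtype.val_injective
  have hred : ∀ᶠ v : FieldSpecialization L in generic L, ∀ j : Algebra.adjoin ℤ {α} →+* v.dom,
      v.dom.subtype.comp j = algebraMap _ L →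
        reducedIdeal (v.toHom.comp j) f = v.specIdeal 𝔞 := by
    filter_upwards [eventually_specIdeal_span_image_eq (K := L) (Set.range f)] with v hv j hj
    have := hv j hj
    rw [← Set.range_comp, ← Set.range_comp] at this
    rw [hf]
    exact this.symm
  have hHF := eventually_affineHilbertFunction_eq 𝔞
  refine ⟨?_, ?_⟩
  · refine (finite_setOf_exists_not_of_eventually (A := Algebra.adjoin ℤ {α}) L
      (hred.and hHF)).subset ?_
    rintro p ⟨hp, ψ, h⟩
    refine ⟨hp, ψ, fun ⟨h1, h2⟩ => h ?_⟩
    have h1 := h1 (toDom L ψ _) (subtype_comp_toDom L ψ _)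
    rw [toHom_comp_toDom] at h1
    rw [← h1] at h2
    exact ⟨h2, hilbertDim_eq_of_affineHilbertFunction_eq h2⟩
  · rintro ⟨𝔠, t, ht, h𝔞t⟩
    have hprime : 𝔞.radical.IsPrime := Ideal.isPrime_radical (ht.primary h𝔞t)
    refine (finite_setOf_exists_not_of_eventually (A := Algebra.adjoin ℤ {α}) L
      ((hred.and hHF).and ((eventually_affineHilbertFunction_eq 𝔞.radical).and
        (eventually_isRadical_specIdeal (A := Algebra.adjoin ℤ {α}) 𝔞.radical)))).subset ?_
    rintro p ⟨hp, ψ, h⟩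
    refine ⟨hp, ψ, fun ⟨⟨h1, h2⟩, h3, h4⟩ => h ?_⟩
    have h1 := h1 (toDom L ψ _) (subtype_comp_toDom L ψ _)
    have h4 := h4 (toDom L ψ _) (subtype_comp_toDom L ψ _)
    rw [toHom_comp_toDom] at h1
    rw [← h4.radical, radical_specIdeal_radical, ← h1] at h3
    rw [← h1] at h2
    exact congrArg₂ _ (hilbertDegree_eq_of_affineHilbertFunction_eq h3)
      (hilbertDegree_eq_of_affineHilbertFunction_eq h2)
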